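/- Let $\mathbb F_2=\{0,1\}$ and let $\ell:\mathbb F_2^n\to\mathbb R$, $\ell(x)=\sum_{i=1}^n x_i$ (the sum being computed in $\mathbb R$), be the OneMax function. Let $\mathcal F_n$ be the class of affine OneMax functions on $\mathbb F_2^n$, i.e. of all functions $f(x)=\ell(Mx+b)$ with $M\in GL(n,\mathbb F_2)$ and $b\in\mathbb F_2^n$, where $Mx+b$ is computed in $\mathbb F_2$. An unrestricted randomized search algorithm $A$ on a finite set $X$ queries points $x_0,x_1,x_2,\dots$ of $X$ one after another: $x_0$ is drawn from a fixed distribution, and for every $t\ge 0$ the query $x_{t+1}$ is drawn from a distribution on $X$ which may depend arbitrarily on $(x_0,f(x_0)),\dots,(x_t,f(x_t))$, where $f:X\to\mathbb R$ is the unknown objective function. Its runtime $T(A,f)$ is the number of evaluations of $f$ up to and including the first evaluation at a global maximizer of $f$ ($T(A,f)=\infty$ if this never happens). The unrestricted black box complexity of a class $\mathcal F$ of functions $X\to\mathbb R$ is $$B_{\mathcal F}=\inf_{A}\,\sup_{f\in\mathcal F}\,\mathbb E\bigl(T(A,f)\bigr),$$ where the infimum is over all unrestricted randomized search algorithms on $X$.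 Then $B_{\mathcal F_n}=O(n^{10}\log^2 n)$ as $n\to\infty$. -/

import Mathlib

open MeasureTheory ProbabilityTheory
open scoped ENNReal

noncomputable section

/-- An unrestricted randomized search (black box) algorithm on the search space `X`: a distribution
for the first query and, for every `t`, a distribution for query number `t + 1` (counting from
`0`) that may depend arbitrarily on the earlier queries `0, …, t` and on the function values
observed at them. -/
structure SearchAlgorithm (X : Type*) where
  /-- distribution of the first query -/
  first : PMF X
  /-- distribution of query `t + 1`, given queries `0, …, t` together with their values -/
  next : (t : ℕ) → (Finset.Iic t → X × ℝ) → PMF X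

namespace SearchAlgorithm

variable {X : Type*} [Finite X] [MeasurableSpace X] [DiscreteMeasurableSpace X]

/-- The transition kernel of `A` run on `f`: from queries `0, …, t` to query `t + 1`. The algorithm
has access to `f` only through its values at the earlier queries. -/
def step (A : SearchAlgorithm X) (f : X → ℝ) (t : ℕ) : Kernel (Finset.Iic t → X) X :=
  Kernel.ofFunOfCountable fun h => (A.next t fun i => (h i, f (h i))).toMeasure

instance (A : SearchAlgorithm X) (f : X → ℝ) (t : ℕ) : IsMarkovKernel (A.step f t) :=
  ⟨fun h => PMF.toMeasure.isProbabilityMeasure (A.next t fun i => (h i, f (h i)))⟩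

/-- The law of the infinite sequence of queries made by `A` when it is run on `f`. -/
def law (A : SearchAlgorithm X) (f : X → ℝ) : Measure (ℕ → X) :=
  Kernel.trajMeasure (X := fun _ => X) A.first.toMeasure (A.step f)

end SearchAlgorithm

/-- The number of evaluations up to and including the first one at a global maximizer of `f`, along
the sequence of queries `ω`; it is `∞` if no query is a global maximizer. -/
def runtime {X : Type*} (f : X → ℝ) (ω : ℕ → X) : ℝ≥0∞ :=
  ⨅ (t : ℕ) (_ : ∀ y, f y ≤ f (ω t)), ((t : ℝ≥0∞) + 1)

/-- The expected runtime `E(T(A, f))`. -/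
def expectedRuntime {X : Type*} [Finite X] [MeasurableSpace X] [DiscreteMeasurableSpace X]
    (A : SearchAlgorithm X) (f : X → ℝ) : ℝ≥0∞ :=
  ∫⁻ ω, runtime f ω ∂(A.law f)

/-- The unrestricted black box complexity of a class `F` of functions on `X`: the infimum over all
randomized search algorithms of the worst-case expected runtime over `F`. -/
def blackBoxComplexity {X : Type*} [Finite X] [MeasurableSpace X] [DiscreteMeasurableSpace X]
    (F : Set (X → ℝ)) : ℝ≥0∞ :=
  ⨅ A : SearchAlgorithm X, ⨆ f ∈ F, expectedRuntime A f

/-- OneMax: the number of ones of a bit vector, as a real number. -/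
def oneMax {n : ℕ} (x : Fin n → ZMod 2) : ℝ := ∑ i, ((x i).val : ℝ)

/-- The class of affine OneMax functions `x ↦ ℓ(Mx + b)` with `M ∈ GL(n, 𝔽₂)`. -/
def affineOneMax (n : ℕ) : Set ((Fin n → ZMod 2) → ℝ) :=
  {f | ∃ (M : Matrix.GeneralLinearGroup (Fin n) (ZMod 2)) (b : Fin n → ZMod 2),
    f = fun x => oneMax ((M : Matrix (Fin n) (Fin n) (ZMod 2)).mulVec x + b)}

end

/-! ### Deterministic search algorithms -/

namespace SearchAlgorithm

variable {X : Type*} [Finite X] [MeasurableSpace X] [DiscreteMeasurableSpace X]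

/-! Only evaluations cost, so it suffices to find O(n³) fixed points whose values determine every
affine OneMax function: query them, then query a maximizer of the only consistent member
(`blackBoxComplexity_le_of_separating`). Up to the factor -1/2, the difference of two such functions
is a ±1 combination G of 2n affine characters. If G ≠ 0, its correlation with one of these
characters is a nonzero multiple of 2ⁿ, while |G| ≤ 2n; so G is nonzero on at least 2ⁿ/(2n) points
(`two_pow_le_card_mul_card_support`). There are at most 2^(2(n²+n)) pairs to separate, and a greedy
choice of 2n(2(n²+n)+1) points separates them all (`exists_hitting_seq`). -/

instance (A : SearchAlgorithm X) (f : X → ℝ) : IsProbabilityMeasure (A.law f) := by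
  have := PMF.toMeasure.isProbabilityMeasure A.first
  unfold law
  infer_instance

lemma map_eval_zero_law (A : SearchAlgorithm X) (f : X → ℝ) :
    (A.law f).map (fun ω => ω 0) = A.first.toMeasure := by
  have hf : (fun ω : ℕ → X => ω 0) =
      (fun x : (i : Finset.Iic 0) → (fun _ : ℕ => X) i => x ⟨0, by simp⟩) ∘
        Preorder.frestrictLe (π := fun _ : ℕ => X) 0 := rfl
  rw [hf, ← Measure.map_map (by fun_prop) (by fun_prop), law, Kernel.trajMeasure,
    Measure.map_comp _ _ (by fun_prop), Kernel.traj_map_frestrictLe, Kernel.partialTraj_self,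
    Measure.id_comp, Measure.map_map (by fun_prop) (by fun_prop)]
  exact Measure.map_id

/-- The first query of an algorithm whose first query is deterministic. -/
lemma ae_law_zero (A : SearchAlgorithm X) (f : X → ℝ) {x : X} (hA : A.first = PMF.pure x) :
    ∀ᵐ ω ∂A.law f, ω 0 = x := by
  have h : ∀ᵐ y ∂(A.law f).map (fun ω => ω 0), y = x := by
    rw [map_eval_zero_law, hA, PMF.toMeasure_pure, ae_dirac_eq]
    exact rfl
  exact ae_of_ae_map (measurable_pi_apply 0).aemeasurable h

/-- The later queries of an algorithm whose queries are deterministic. -/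
lemma ae_law_succ (A : SearchAlgorithm X) (f : X → ℝ) (t : ℕ) {d : (Finset.Iic t → X × ℝ) → X}
    (hA : ∀ h, A.next t h = PMF.pure (d h)) :
    ∀ᵐ ω ∂A.law f, ω (t + 1) = d fun i => (ω i, f (ω i)) := by
  have := PMF.toMeasure.isProbabilityMeasure A.first
  have h : ∀ᵐ p ∂(A.law f).map
      (fun ω => (Preorder.frestrictLe (π := fun _ : ℕ => X) t ω, ω (t + 1))),
      p.2 = d fun i => (p.1 i, f (p.1 i)) := by
    rw [law, ← Kernel.map_frestrictLe_trajMeasure_compProd_eq_map_trajMeasure]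
    refine Measure.ae_compProd_of_ae_ae (MeasurableSet.of_discrete
      (α := ((i : Finset.Iic t) → X) × X)) (Filter.Eventually.of_forall fun h => ?_)
    change ∀ᵐ y ∂(A.next t fun i => (h i, f (h i))).toMeasure, _
    rw [hA, PMF.toMeasure_pure, ae_dirac_eq]
    exact rfl
  exact ae_of_ae_map (by fun_prop) h

end SearchAlgorithm

/-- If the members of a class are determined by their values at `m` fixed points, then querying
these points and then an optimum of the only consistent member takes `m + 1` evaluations. -/
theorem blackBoxComplexity_le_of_separating {X : Type*} [Finite X] [MeasurableSpace X]
    [DiscreteMeasurableSpace X] (F : Set (X → ℝ)) (m : ℕ) (s : ℕ → X)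
    (hs : ∀ f ∈ F, ∀ g ∈ F, (∀ t < m, f (s t) = g (s t)) → f = g) :
    blackBoxComplexity F ≤ (m : ℝ≥0∞) + 1 := by
  classical
  have : Nonempty X := ⟨s 0⟩
  choose argmax hmax using fun f : X → ℝ => Finite.exists_max f
  let consistent (t : ℕ) (h : Finset.Iic t → X × ℝ) (f : X → ℝ) : Prop :=
    f ∈ F ∧ ∀ i, f (h i).1 = (h i).2
  let d (t : ℕ) (h : Finset.Iic t → X × ℝ) : X :=
    -- `next t` produces query `t + 1`, so queries `0, …, m - 1` are the fixed points and query `m`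
    -- is the guess. For `m = 0` the guess is already `first`.
    if t + 1 < m then s (t + 1) else argmax (Classical.epsilon (consistent t h))
  let A : SearchAlgorithm X :=
    { first := PMF.pure (if 0 < m then s 0 else argmax (Classical.epsilon (· ∈ F)))
      next := fun t h => PMF.pure (d t h) }
  refine iInf_le_of_le A (iSup₂_le fun f hf => ?_)
  have hrun : ∀ᵐ ω ∂A.law f, runtime f ω ≤ (m : ℝ≥0∞) + 1 := by
    filter_upwards [A.ae_law_zero f rfl,
      ae_all_iff.2 fun t => A.ae_law_succ f t (d := d t) fun _ => rfl] with ω h0 hsucc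
    refine iInf₂_le m ?_
    rcases m with _ | m
    · have hε : Classical.epsilon (· ∈ F) ∈ F := Classical.epsilon_spec (p := (· ∈ F)) ⟨f, hf⟩
      have : Classical.epsilon (· ∈ F) = f := hs _ hε _ hf (by simp)
      rw [h0, if_neg (lt_irrefl _), this]
      exact hmax f
    · have hq : ∀ t < m + 1, ω t = s t := by
        rintro (_ | t) ht
        · rw [h0, if_pos ht]
        · rw [hsucc]
          exact if_pos ht
      have hε : consistent m (fun i => (ω i, f (ω i)))
          (Classical.epsilon (consistent m fun i => (ω i, f (ω i)))) :=
        Classical.epsilon_spec (p := consistent m fun i => (ω i, f (ω i))) ⟨f, hf, fun _ => rfl⟩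
      have : Classical.epsilon (consistent m fun i => (ω i, f (ω i))) = f := by
        refine hs _ hε.1 _ hf fun t ht => ?_
        rw [← hq t ht]
        exact hε.2 ⟨t, Finset.mem_Iic.2 (Nat.lt_succ_iff.1 ht)⟩
      have hω : ω (m + 1) = argmax f := by
        rw [hsucc]
        simp only [d, lt_irrefl, if_false, this]
      rw [hω]
      exact hmax f
  calc expectedRuntime A f ≤ ∫⁻ _, ((m : ℝ≥0∞) + 1) ∂A.law f := lintegral_mono_ae hrun
    _ = (m : ℝ≥0∞) + 1 := by simp

/-! ### Small hitting sequences -/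

section Hitting

variable {ι X : Type*} [Fintype X] [Nonempty X] (r : ι → X → Prop) [∀ i x, Decidable (r i x)]

/-- Double counting: an average point satisfies at least a fraction 1/(k+1) of the relations, so
some point does. -/
lemma exists_card_filter_not_le (k : ℕ) (I : Finset ι)
    (h : ∀ i ∈ I, Fintype.card X ≤ (k + 1) * (Finset.univ.filter (r i)).card) :
    ∃ x, (k + 1) * (I.filter fun i => ¬ r i x).card ≤ k * I.card := by
  have hsum : ∑ _x : X, I.card ≤ ∑ x : X, (k + 1) * (I.filter fun i => r i x).card := by
    rw [← Finset.mul_sum]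
    have := Finset.sum_card_bipartiteAbove_eq_sum_card_bipartiteBelow (s := I)
      (t := (Finset.univ : Finset X)) r
    simp only [Finset.bipartiteAbove, Finset.bipartiteBelow] at this
    rw [← this, Finset.mul_sum, Finset.sum_const, Finset.card_univ, smul_eq_mul, mul_comm,
      ← smul_eq_mul, ← Finset.sum_const]
    exact Finset.sum_le_sum h
  obtain ⟨x, -, hx⟩ := Finset.exists_le_of_sum_le Finset.univ_nonempty hsum
  refine ⟨x, ?_⟩
  have := I.card_filter_add_card_filter_not (fun i => r i x)
  nlinarith

/-- Greedy iteration: each new point leaves at most a fraction k/(k+1) of the surviving relations.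
-/
lemma exists_seq_card_filter_le (k m : ℕ) (I : Finset ι)
    (h : ∀ i ∈ I, Fintype.card X ≤ (k + 1) * (Finset.univ.filter (r i)).card) :
    ∃ s : ℕ → X, (k + 1) ^ m * (I.filter fun i => ∀ t < m, ¬ r i (s t)).card ≤ k ^ m * I.card := by
  induction m generalizing I with
  | zero => exact ⟨fun _ => Classical.arbitrary X, by simp⟩
  | succ m ih =>
    obtain ⟨x, hx⟩ := exists_card_filter_not_le r k I h
    obtain ⟨s, hs⟩ := ih (I.filter fun i => ¬ r i x) fun i hi => h i (Finset.mem_filter.1 hi).1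
    refine ⟨fun t => Nat.casesOn t x s, ?_⟩
    have hfilter : (I.filter fun i => ∀ t < m + 1, ¬ r i (Nat.casesOn t x s)) =
        (I.filter fun i => ¬ r i x).filter fun i => ∀ t < m, ¬ r i (s t) := by
      rw [Finset.filter_filter]
      refine Finset.filter_congr fun i _ => ⟨fun H => ⟨H 0 (by simp), fun t ht => H (t + 1)
        (by simpa using ht)⟩, ?_⟩
      rintro ⟨h0, hs⟩ (_ | t) ht
      · exact h0
      · exact hs t (by simpa using ht)
    rw [hfilter, pow_succ' (k + 1), pow_succ k, mul_assoc, mul_assoc]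
    calc _ ≤ (k + 1) * (k ^ m * (I.filter fun i => ¬ r i x).card) := Nat.mul_le_mul_left _ hs
      _ = k ^ m * ((k + 1) * (I.filter fun i => ¬ r i x).card) := by ring
      _ ≤ _ := Nat.mul_le_mul_left _ hx

/-- Keeps two terms of the binomial expansion. Thus k+1 greedy steps at least halve the survivors.
-/
lemma two_mul_pow_succ_le (k : ℕ) : 2 * k ^ (k + 1) ≤ (k + 1) ^ (k + 1) := by
  have h : k ^ (k + 1) + (k + 1) * k ^ k ≤ (k + 1) ^ (k + 1) := by
    rw [add_pow, Finset.sum_range_succ, Finset.sum_range_succ]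
    simp only [one_pow, mul_one, Nat.choose_self, Nat.choose_succ_self_right, Nat.cast_id]
    linarith [Nat.zero_le (∑ x ∈ Finset.range k, k ^ x * (k + 1).choose x)]
  calc 2 * k ^ (k + 1) = k ^ (k + 1) + k * k ^ k := by ring
    _ ≤ k ^ (k + 1) + (k + 1) * k ^ k := by gcongr; omega
    _ ≤ _ := h

/-- If every relation in a family of fewer than `2 ^ L` is satisfied by a fraction `1 / (k + 1)` of
all points, then some sequence of `(k + 1) * L` points hits them all. -/
lemma exists_hitting_seq {k : ℕ} (hk : 0 < k) (L : ℕ) (I : Finset ι) (hI : I.card < 2 ^ L)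
    (h : ∀ i ∈ I, Fintype.card X ≤ (k + 1) * (Finset.univ.filter (r i)).card) :
    ∃ s : ℕ → X, ∀ i ∈ I, ∃ t < (k + 1) * L, r i (s t) := by
  obtain ⟨s, hs⟩ := exists_seq_card_filter_le r k ((k + 1) * L) I h
  refine ⟨s, ?_⟩
  set N := (I.filter fun i => ∀ t < (k + 1) * L, ¬ r i (s t)).card with hN
  have hpos : 0 < k ^ ((k + 1) * L) := pow_pos hk _
  have hpow : 2 ^ L * k ^ ((k + 1) * L) ≤ (k + 1) ^ ((k + 1) * L) := by
    rw [pow_mul, pow_mul, ← mul_pow]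
    exact Nat.pow_le_pow_left (two_mul_pow_succ_le k) L
  -- After L halvings of fewer than 2^L relations, less than one survives.
  have hN0 : N = 0 := by
    by_contra hne
    have h1 : 1 ≤ N := Nat.one_le_iff_ne_zero.2 hne
    have h2 : k ^ ((k + 1) * L) * 2 ^ L ≤ k ^ ((k + 1) * L) * I.card := by
      calc _ = 2 ^ L * k ^ ((k + 1) * L) := mul_comm _ _
        _ ≤ (k + 1) ^ ((k + 1) * L) * 1 := by simpa using hpow
        _ ≤ _ := (Nat.mul_le_mul_left _ h1).trans hs
    exact absurd (Nat.le_of_mul_le_mul_left h2 hpos) (not_le.2 hI)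
  intro i hi
  by_contra hcon
  push Not at hcon
  exact (Finset.eq_empty_iff_forall_notMem.1 (Finset.card_eq_zero.1 hN0)) i
    (Finset.mem_filter.2 ⟨hi, hcon⟩)

end Hitting

/-! ### Integer combinations of affine characters of `𝔽₂ⁿ` -/

/-- The nontrivial character of `𝔽₂`. -/
def signChar (a : ZMod 2) : ℤ := 1 - 2 * (a.val : ℤ)

lemma signChar_add : ∀ a b : ZMod 2, signChar (a + b) = signChar a * signChar b := by
  unfold signChar; decide

lemma abs_signChar : ∀ a : ZMod 2, |signChar a| = 1 := by
  unfold signChar; decide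

lemma signChar_add_one : ∀ a : ZMod 2, signChar (a + 1) = -signChar a := by
  unfold signChar; decide

lemma two_pow_dvd_sum_signChar {n : ℕ} (u : Fin n → ZMod 2) (c : ZMod 2) :
    (2 : ℤ) ^ n ∣ ∑ x : Fin n → ZMod 2, signChar (u ⬝ᵥ x + c) := by
  by_cases hu : u = 0
  · simp [hu, ZMod.card]
  · obtain ⟨i, hi⟩ := Function.ne_iff.1 hu
    have hi1 : u i = 1 := by
      have : ∀ a : ZMod 2, a ≠ 0 → a = 1 := by decide
      exact this _ hi
    -- Translation by the i-th basis vector flips every sign.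
    have hneg : ∑ x : Fin n → ZMod 2, signChar (u ⬝ᵥ x + c) =
        -∑ x : Fin n → ZMod 2, signChar (u ⬝ᵥ x + c) := by
      rw [← Finset.sum_neg_distrib]
      refine Fintype.sum_equiv (Equiv.addRight (Pi.single i (1 : ZMod 2))) _ _ fun x => ?_
      rw [Equiv.coe_addRight, dotProduct_add, dotProduct_single, hi1, mul_one,
        add_right_comm, signChar_add_one, neg_neg]
    have : ∑ x : Fin n → ZMod 2, signChar (u ⬝ᵥ x + c) = 0 := by linarith
    rw [this]
    exact dvd_zero _

/-- A nonzero combination of affine characters with coefficients in `{-1, 0, 1}` is nonzero on a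
large set of points. -/
lemma two_pow_le_card_mul_card_support {n : ℕ} {J : Type*} [Fintype J] (c : J → ℤ)
    (hc : ∀ j, |c j| ≤ 1) (u : J → Fin n → ZMod 2) (e : J → ZMod 2)
    (hne : ∃ x, ∑ j, c j * signChar (u j ⬝ᵥ x + e j) ≠ 0) :
    2 ^ n ≤ Fintype.card J *
      (Finset.univ.filter fun x => ∑ j, c j * signChar (u j ⬝ᵥ x + e j) ≠ 0).card := by
  set G : (Fin n → ZMod 2) → ℤ := fun x => ∑ j, c j * signChar (u j ⬝ᵥ x + e j) with hG
  -- Otherwise G would be orthogonal to each of its own terms, hence to itself.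
  obtain ⟨j, hj⟩ : ∃ j, ∑ x, G x * signChar (u j ⬝ᵥ x + e j) ≠ 0 := by
    by_contra! hcon
    have hsq : ∑ x, G x ^ 2 = 0 := by
      calc ∑ x, G x ^ 2 = ∑ x, ∑ j, c j * (G x * signChar (u j ⬝ᵥ x + e j)) := by
            refine Finset.sum_congr rfl fun x _ => ?_
            rw [sq]
            nth_rewrite 2 [hG]
            rw [Finset.mul_sum]
            exact Finset.sum_congr rfl fun j _ => by ring
        _ = ∑ j, c j * ∑ x, G x * signChar (u j ⬝ᵥ x + e j) := by
            rw [Finset.sum_comm]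
            simp only [Finset.mul_sum]
        _ = 0 := by simp [hcon]
    obtain ⟨x, hx⟩ := hne
    have := (Finset.sum_eq_zero_iff_of_nonneg fun x _ => sq_nonneg (G x)).1 hsq x
      (Finset.mem_univ x)
    exact hx (pow_eq_zero_iff two_ne_zero |>.1 this)
  have hdvd : (2 : ℤ) ^ n ∣ ∑ x, G x * signChar (u j ⬝ᵥ x + e j) := by
    have : ∑ x, G x * signChar (u j ⬝ᵥ x + e j) =
        ∑ i, c i * ∑ x, signChar ((u i + u j) ⬝ᵥ x + (e i + e j)) := by
      simp only [Finset.mul_sum]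
      rw [Finset.sum_comm]
      refine Finset.sum_congr rfl fun x _ => ?_
      simp only [hG, Finset.sum_mul]
      refine Finset.sum_congr rfl fun i _ => ?_
      rw [add_dotProduct, add_add_add_comm, signChar_add (u i ⬝ᵥ x + e i), mul_assoc]
    rw [this]
    exact Finset.dvd_sum fun i _ => Dvd.dvd.mul_left (two_pow_dvd_sum_signChar _ _) _
  have hlow : (2 : ℤ) ^ n ≤ |∑ x, G x * signChar (u j ⬝ᵥ x + e j)| :=
    Int.le_of_dvd (abs_pos.2 hj) ((dvd_abs _ _).2 hdvd)
  have hGle (x) : |G x| ≤ if G x ≠ 0 then (Fintype.card J : ℤ) else 0 := by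
    split_ifs with h
    · calc |G x| ≤ ∑ j, |c j * signChar (u j ⬝ᵥ x + e j)| := Finset.abs_sum_le_sum_abs _ _
        _ ≤ ∑ _j : J, (1 : ℤ) := Finset.sum_le_sum fun j _ => by
            rw [abs_mul, abs_signChar, mul_one]; exact hc j
        _ = Fintype.card J := by simp
    · rw [not_not.1 h, abs_zero]
  have hup : |∑ x, G x * signChar (u j ⬝ᵥ x + e j)| ≤
      (Fintype.card J : ℤ) * (Finset.univ.filter fun x => G x ≠ 0).card := by
    calc _ ≤ ∑ x, |G x * signChar (u j ⬝ᵥ x + e j)| := Finset.abs_sum_le_sum_abs _ _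
      _ ≤ ∑ x, if G x ≠ 0 then (Fintype.card J : ℤ) else 0 := Finset.sum_le_sum fun x _ => by
          rw [abs_mul, abs_signChar, mul_one]; exact hGle x
      _ = _ := by rw [← Finset.sum_filter, Finset.sum_const, nsmul_eq_mul, mul_comm]
  exact_mod_cast hlow.trans hup

/-! ### Affine OneMax functions -/

lemma two_mul_oneMax {n : ℕ} (x : Fin n → ZMod 2) :
    2 * oneMax x = n - ((∑ i, signChar (x i) : ℤ) : ℝ) := by
  simp [oneMax, signChar, Finset.mul_sum]

lemma oneMax_ne_iff {n : ℕ} (x y : Fin n → ZMod 2) :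
    oneMax x ≠ oneMax y ↔ ∑ i, signChar (x i) - ∑ i, signChar (y i) ≠ 0 := by
  have hx := two_mul_oneMax x
  have hy := two_mul_oneMax y
  rw [not_iff_not, sub_eq_zero, ← Int.cast_inj (α := ℝ)]
  constructor <;> intro h <;> linarith

/-- The function `x ↦ ℓ(Mx + b)` for an arbitrary square matrix `M`. -/
def affineOneMaxFun {n : ℕ} (p : Matrix (Fin n) (Fin n) (ZMod 2) × (Fin n → ZMod 2))
    (x : Fin n → ZMod 2) : ℝ :=
  oneMax (p.1.mulVec x + p.2)

lemma two_pow_le_card_affineOneMaxFun_ne {n : ℕ}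
    (p q : Matrix (Fin n) (Fin n) (ZMod 2) × (Fin n → ZMod 2))
    (h : affineOneMaxFun p ≠ affineOneMaxFun q) :
    2 ^ n ≤ 2 * n *
      (Finset.univ.filter fun x => affineOneMaxFun p x ≠ affineOneMaxFun q x).card := by
  have key (x) : affineOneMaxFun p x ≠ affineOneMaxFun q x ↔
      ∑ j : Fin n ⊕ Fin n, Sum.elim (fun _ => (1 : ℤ)) (fun _ => -1) j *
        signChar (Sum.elim p.1 q.1 j ⬝ᵥ x + Sum.elim p.2 q.2 j) ≠ 0 := by
    rw [affineOneMaxFun, affineOneMaxFun, oneMax_ne_iff, Fintype.sum_sum_type]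
    simp only [Sum.elim_inl, Sum.elim_inr, one_mul, neg_one_mul, Finset.sum_neg_distrib,
      ← sub_eq_add_neg]
    rfl
  obtain ⟨x, hx⟩ := Function.ne_iff.1 h
  have := two_pow_le_card_mul_card_support (J := Fin n ⊕ Fin n)
    (Sum.elim (fun _ => (1 : ℤ)) (fun _ => -1)) (by rintro (_ | _) <;> simp)
    (Sum.elim p.1 q.1) (Sum.elim p.2 q.2) ⟨x, (key x).1 hx⟩
  simp only [← key] at this
  simpa [two_mul] using this

lemma blackBoxComplexity_affineOneMax_le {n : ℕ} (hn : 0 < n) :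
    blackBoxComplexity (affineOneMax n) ≤
      ((2 * n * (2 * (n * n + n) + 1) : ℕ) : ℝ≥0∞) + 1 := by
  classical
  obtain ⟨k, hk⟩ : ∃ k, 2 * n = k + 1 := ⟨2 * n - 1, by omega⟩
  let P := Matrix (Fin n) (Fin n) (ZMod 2) × (Fin n → ZMod 2)
  have hP : Fintype.card P = 2 ^ (n * n + n) := by
    rw [Fintype.card_prod, ← Fintype.card_congr (Matrix.of (m := Fin n) (n := Fin n) (α := ZMod 2))]
    simp only [Fintype.card_fun, ZMod.card, Fintype.card_fin, ← pow_mul, pow_add]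
  let I : Finset (P × P) :=
    Finset.univ.filter fun i => affineOneMaxFun i.1 ≠ affineOneMaxFun i.2
  -- The extra 1 in the exponent provides strict inequality.
  have hI : I.card < 2 ^ (2 * (n * n + n) + 1) := by
    calc I.card ≤ Fintype.card (P × P) := Finset.card_le_univ _
      _ = 2 ^ (2 * (n * n + n)) := by rw [Fintype.card_prod, hP, ← pow_add, two_mul]
      _ < _ := Nat.pow_lt_pow_right one_lt_two (Nat.lt_succ_self _)
  obtain ⟨s, hs⟩ := exists_hitting_seq
    (fun (i : P × P) x => affineOneMaxFun i.1 x ≠ affineOneMaxFun i.2 x)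
    (k := k) (by omega) _ I hI fun i hi => by
      rw [← hk, Fintype.card_fun, ZMod.card, Fintype.card_fin]
      exact two_pow_le_card_affineOneMaxFun_ne i.1 i.2 (Finset.mem_filter.1 hi).2
  refine blackBoxComplexity_le_of_separating _ _ s ?_
  rintro _ ⟨M, b, rfl⟩ _ ⟨M', b', rfl⟩ hagree
  by_contra hne
  obtain ⟨t, ht, hst⟩ := hs ((M.1, b), (M'.1, b'))
    (Finset.mem_filter.2 ⟨Finset.mem_univ _, hne⟩)
  exact hst (hagree t (hk ▸ ht))

theorem mainTheorem1 :
    ∃ C : ℝ, ∀ᶠ n : ℕ in Filter.atTop,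
      blackBoxComplexity (affineOneMax n) ≤
        ENNReal.ofReal (C * ((n : ℝ) ^ 10 * Real.log n ^ 2)) := by
  -- The bound is 4n³ + 4n² + 2n + 1, and 4 + 4 + 2 + 1 = 11. From n ≥ 3 > e on, log n ≥ 1.
  refine ⟨11, ?_⟩
  filter_upwards [Filter.eventually_ge_atTop 3] with n hn
  refine (blackBoxComplexity_affineOneMax_le (by omega)).trans ?_
  have hn1 : (1 : ℝ) ≤ n := by exact_mod_cast (by omega : 1 ≤ n)
  have hn3 : (3 : ℝ) ≤ n := by exact_mod_cast hn
  have hlog : 1 ≤ Real.log n := by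
    rw [Real.le_log_iff_exp_le (by linarith)]
    linarith [Real.exp_one_lt_d9]
  have hpow : (n : ℝ) ^ 3 ≤ (n : ℝ) ^ 10 * Real.log n ^ 2 :=
    calc (n : ℝ) ^ 3 ≤ (n : ℝ) ^ 10 := pow_le_pow_right₀ hn1 (by norm_num)
      _ ≤ _ := le_mul_of_one_le_right (by positivity) (one_le_pow₀ hlog)
  have hpoly : 2 * n * (2 * (n * n + n) + 1) + 1 ≤ 11 * (n : ℝ) ^ 3 := by
    have h2 : (n : ℝ) ^ 2 ≤ (n : ℝ) ^ 3 := pow_le_pow_right₀ hn1 (by norm_num)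
    have h1 : (n : ℝ) ≤ (n : ℝ) ^ 3 := le_self_pow₀ hn1 (by norm_num)
    nlinarith
  rw [← Nat.cast_add_one, ← ENNReal.ofReal_natCast]
  refine ENNReal.ofReal_le_ofReal ?_
  push_cast
  linarith
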